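/- Let $q$ be a prime power, $A=\mathbb F_q[t]$, $K=\mathbb F_q(t)$, and let $K_\infty=\mathbb F_q((1/t))$ be the completion of $K$ at the infinite place. Put $[n]=t^{q^n}-t$ and $\ell_n=\prod_{i=1}^n(t-t^{q^i})$. For integers $d\ge 0$ and $s\ge1$ let $S_d(s)=\sum 1/a^s\in K$, the sum over all monic $a\in A$ of degree $d$, and for positive integers $s_1,\dots,s_r$ let $$\zeta(s_1,\dots,s_r)=\sum_{d_1>\dots>d_r\ge 0}S_{d_1}(s_1)\cdots S_{d_r}(s_r)\in K_\infty .$$ These series converge (unconditionally) in $K_\infty$, and the following identities hold. 1. If $n>0$, $1\le s<q$ and $0\le k_i<n$ for $1\le i\le s$, then $$\zeta\Bigl(q^n-\sum_{i=1}^s q^{k_i},\,(q-1)q^n\Bigr)=\frac{(-1)^s}{\ell_1^{q^n}}\prod_{i=1}^s[n-k_i]^{q^{k_i}}\;\zeta\Bigl(q^{n+1}-\sum_{i=1}^s q^{k_i}\Bigr).$$ 2. If $n\ge0$, $1\le s_1\le q$, $0\le s_2\le q-s_1$ and $0\le k_i\le n+1$ for $1\le i\le s_2$, then for $a=s_1q^n$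 and $b=s_1(q^{n+1}-q^n)+\sum_{i=1}^{s_2}(q^{n+1}-q^{k_i})$, $$\zeta(a,b)=\frac1{\ell_1^{s_1q^n}}\,\zeta(a+b).$$ 3. $$\zeta\bigl(q^2-(q-1),\,(q-1)(q^2+1)\bigr)=\frac{1-[2]^q}{\ell_1^{q^2-1}\ell_2}\,\zeta(q^3).$$ 4. $$\zeta\bigl(2q-1,\,(q-1)(q^2+q-1)\bigr)=\frac{1-[2]^q}{\ell_1^{q+1}\ell_2^{q-1}}\,\zeta(q^3).$$ 5. $$\zeta(1,q^2-1)=\Bigl(\frac1{\ell_1}+\frac1{\ell_2}\Bigr)\zeta(q^2).$$ 6. If $q>2$, $n\ge0$ and $-1\le j\le n$, then $$\zeta\bigl((q-1)q^n-1,\,(q-1)q^{n+1}+q^n-q^{n-j}\bigr)=-\frac{[n+1]}{[1]^{(q-1)q^n}}\,\zeta\bigl(q^{n+2}-q^{n-j}-1\bigr).$$ -/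

import Mathlib

open Polynomial

noncomputable section

namespace MultizetaFq

/-- For a finite field `F` there are only finitely many monic polynomials of degree `d`. -/
theorem finite_monic_natDegree (F : Type*) [Field F] [Fintype F] (d : ℕ) :
    {a : F[X] | a.Monic ∧ a.natDegree = d}.Finite := by
  have : Finite (degreeLT F (d + 1)) := Finite.of_equiv _ (degreeLTEquiv F (d + 1)).toEquiv.symm
  refine (Set.toFinite (degreeLT F (d + 1) : Set F[X])).subset ?_
  rintro a ⟨-, rfl⟩
  exact mem_degreeLT.2 (lt_of_le_of_lt degree_le_natDegree (by exact_mod_cast Nat.lt_succ_self _))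

/-- `A_{d+}`: the monic polynomials of degree `d` in `A = F[t]`. -/
def monicsOfDegree (F : Type*) [Field F] [Fintype F] (d : ℕ) : Finset F[X] :=
  (finite_monic_natDegree F d).toFinset

/-- The power sum `S_d(s) = ∑ 1 / a ^ s` over monic `a` of degree `d`, an element of
`K = F(t)`. -/
def powerSum (F : Type*) [Field F] [Fintype F] (d s : ℕ) : RatFunc F :=
  ∑ a ∈ monicsOfDegree F d, 1 / (algebraMap F[X] (RatFunc F) a) ^ s

/-- `[n] = t ^ (q ^ n) - t`, where `q` is the number of elements of `F`. -/
def bracket (F : Type*) [Field F] [Fintype F] (n : ℕ) : RatFunc F :=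
  RatFunc.X ^ (Fintype.card F ^ n) - RatFunc.X

/-- `ℓ_n = ∏_{i=1}^n (t - t ^ (q ^ i))`. -/
def ell (F : Type*) [Field F] [Fintype F] (n : ℕ) : RatFunc F :=
  ∏ i ∈ Finset.Icc 1 n, (RatFunc.X - RatFunc.X ^ (Fintype.card F ^ i))

/-- The term `S_{d_1}(s_1) ⋯ S_{d_r}(s_r)` of the multizeta series, for `d_1 > ⋯ > d_r ≥ 0`, in
the completion `K_∞ = F((1/t))` of `K` at the infinite place. -/
def multizetaTerm (F : Type*) [Field F] [Fintype F] [DecidableEq (RatFunc F)] {r : ℕ}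
    (s : Fin r → ℕ) (d : {d : Fin r → ℕ // StrictAnti d}) : RatFunc.CompletionAtInfty F :=
  algebraMap (RatFunc F) (RatFunc.CompletionAtInfty F) (∏ i, powerSum F (d.1 i) (s i))

/-- The multizeta value `ζ(s_1, …, s_r) = ∑_{d_1 > ⋯ > d_r ≥ 0} S_{d_1}(s_1) ⋯ S_{d_r}(s_r)` in
`K_∞`. In depth `r = 1` this is the Carlitz zeta value. -/
def multizeta (F : Type*) [Field F] [Fintype F] [DecidableEq (RatFunc F)] {r : ℕ}
    (s : Fin r → ℕ) : RatFunc.CompletionAtInfty F :=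
  ∑' d, multizetaTerm F s d

end MultizetaFq

end

/-!
Write `q` for the number of elements of `F` and `S_{<d}(b) = ∑_{j < d} S_j(b)`, so that
`ζ(a, b) = ∑_d S_d(a) S_{<d}(b)`. The values of both factors can be computed in closed form, and in
every case the product `S_{d+1}(a) S_{<d+1}(b)` is a constant multiple of `S_d(a + b)`, up to a
telescoping term in three of the identities.

*The closed form.* For `T = t ^ (q ^ N)` and a polynomial `a`, one has `a(T) = a ^ (q ^ N)`. The
function `a(T) ↦ a(x)` on polynomials of degree at most `d` is `F`-linear, and Carlitz' expansion
`a(x) = ∑_{j ≤ d} (∏_{l < j} (x - T ^ (q ^ l))) e_j(a(T))` writes it as an explicit `F`-linear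
polynomial in `a(T)` of degree at most `q ^ d`, where `e_j(a(T))` is the coefficient of `t ^ j` in
`a` if `deg a ≤ j` (`carlitzMap_aeval`, `aeval_eq_sum_carlitzMap`). After division by the variable it
becomes the polynomial `interpQuot`, whose value at `0` is a product (`eval_zero_interpQuot`). Taking
`x = t ^ (q ^ k_i)`, a product of at most `q` such factors evaluated at `a(T)` is
`∏ a ^ (q ^ k_i - q ^ N)`. It has degree less than `q ^ (d + 1) - 1` in `a(T)`, so its sum over all
`q ^ (d + 1)` polynomials of degree at most `d` vanishes (`sum_eval_eq_zero`); hence the sum over the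
nonzero ones is minus the value at `0`. Since the summand is invariant under multiplication of `a` by
constants, this is minus the sum over monic polynomials, which evaluates `S_{<d+1}(e)` for
`e = m q ^ N - ∑ q ^ k_i` with `m` summands, `m ≤ q` (`sum_powerSum`). Extra factors
`e_d(a(T)) / a(T)` restrict the sum to degree exactly `d`, which evaluates `S_d(e)` when there are
fewer than `m` summands (`powerSum_eq`). Both are the same product of quotients `ellQuot` of the `ℓ_n`.

*The telescoping.* When `S_{d+1}(a) S_{<d+1}(b) = -c [d+2] ^ (q ^ e) S_d(w)` with
`w = q ^ (e + 2)`, the relations `[d+2] - [2] = [d] ^ (q ^ 2)` and `[d] / ℓ_d = -1 / ℓ_{d-1}` turn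
`[d+2]` into `[2] - 1` at the cost of a telescoping series
(`multizeta_eq_smul_of_bracket`).

*Convergence.* `S_d(s)` has valuation at most `exp (-d s)` at infinity, and in a complete
nonarchimedean group a family tending to zero is summable.
-/

noncomputable section

namespace MultizetaFq

open Filter Topology WithZero

/-! ### Carlitz polynomials and interpolation of `a(T) ↦ a(x)` -/

section Carlitz

variable {F K : Type*} [Field F] [Fintype F] [Field K]

variable (F) in
/-- The polynomial `e_j(X) / X`, where `e_j` is the Carlitz polynomial for the parameter `T`,
normalised to take the value `1` at `T ^ j`; see `mul_eval_carlitzQuot`. -/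
def carlitzQuot (T : K) : ℕ → K[X]
  | 0 => 1
  | j + 1 => C (T ^ Fintype.card F ^ (j + 1) - T)⁻¹ *
      (X ^ (Fintype.card F - 1) * carlitzQuot T j ^ Fintype.card F - carlitzQuot T j)

theorem natDegree_carlitzQuot (T : K) (j : ℕ) :
    (carlitzQuot F T j).natDegree ≤ Fintype.card F ^ j - 1 := by
  induction j with
  | zero => simp [carlitzQuot]
  | succ j ih =>
    have hq : 0 < Fintype.card F := Fintype.card_pos
    have hqj : 0 < Fintype.card F ^ j := pow_pos hq j
    have h1 : Fintype.card F - 1 + Fintype.card F * (Fintype.card F ^ j - 1) =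
        Fintype.card F ^ (j + 1) - 1 := by
      rw [Nat.mul_sub, pow_succ', mul_one]
      have : Fintype.card F ≤ Fintype.card F * Fintype.card F ^ j := Nat.le_mul_of_pos_right _ hqj
      omega
    rw [carlitzQuot, ← h1]
    refine (natDegree_C_mul_le _ _).trans ((natDegree_sub_le _ _).trans (max_le ?_ ?_))
    · refine natDegree_mul_le.trans (add_le_add (natDegree_X_pow_le _) ?_)
      exact natDegree_pow_le.trans (Nat.mul_le_mul_left _ ih)
    · exact ih.trans ((Nat.le_mul_of_pos_left _ hq).trans (Nat.le_add_left _ _))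

theorem eval_zero_carlitzQuot (T : K) (j : ℕ) :
    (carlitzQuot F T j).eval 0 = ∏ i ∈ Finset.Icc 1 j, (T - T ^ Fintype.card F ^ i)⁻¹ := by
  have hq : Fintype.card F - 1 ≠ 0 := by have := Fintype.one_lt_card (α := F); omega
  induction j with
  | zero => simp [carlitzQuot]
  | succ j ih =>
    rw [Finset.prod_Icc_succ_top (by omega), ← ih, carlitzQuot]
    simp only [eval_mul, eval_C, eval_sub, eval_pow, eval_X, zero_pow hq]
    rw [← neg_sub T, inv_neg]
    ring

variable (F) in
/-- The polynomial `L(X) / X`, where `L` is the `F`-linear polynomial with `L(a(T)) = a(x)` for all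
`a` of degree at most `d`; see `mul_eval_interpQuot`. -/
def interpQuot (T x : K) (d : ℕ) : K[X] :=
  ∑ j ∈ Finset.range (d + 1), C (∏ l ∈ Finset.range j, (x - T ^ Fintype.card F ^ l)) *
    carlitzQuot F T j

theorem natDegree_interpQuot (T x : K) (d : ℕ) :
    (interpQuot F T x d).natDegree ≤ Fintype.card F ^ d - 1 := by
  refine natDegree_sum_le_of_forall_le _ _ fun j hj ↦ (natDegree_C_mul_le _ _).trans
    ((natDegree_carlitzQuot T j).trans (Nat.sub_le_sub_right ?_ 1))
  exact Nat.pow_le_pow_right Fintype.card_pos (by simpa [Nat.lt_succ_iff] using hj)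

theorem eval_zero_interpQuot {T : K} (hT : ∀ i, T ^ Fintype.card F ^ (i + 1) - T ≠ 0)
    (x : K) (d : ℕ) :
    (interpQuot F T x d).eval 0 =
      ∏ i ∈ Finset.Icc 1 d, ((x - T ^ Fintype.card F ^ i) / (T - T ^ Fintype.card F ^ i)) := by
  rw [interpQuot, eval_finsetSum]
  simp only [eval_mul, eval_C, eval_zero_carlitzQuot]
  induction d with
  | zero => simp
  | succ d ih =>
    have h : T - T ^ Fintype.card F ^ (d + 1) ≠ 0 := by
      rw [← neg_sub]; exact neg_ne_zero.2 (hT d)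
    rw [Finset.sum_range_succ, ih, Finset.prod_Icc_succ_top (by omega),
      Finset.prod_Icc_succ_top (by omega), Finset.prod_range_succ']
    have h2 : ∏ l ∈ Finset.range d, (x - T ^ Fintype.card F ^ (l + 1)) =
        ∏ i ∈ Finset.Icc 1 d, (x - T ^ Fintype.card F ^ i) := by
      rw [Finset.range_eq_Ico, Finset.prod_Ico_add' (fun i ↦ x - T ^ Fintype.card F ^ i)]
      rfl
    rw [h2, Finset.prod_div_distrib, Finset.prod_inv_distrib, pow_zero, pow_one]
    field_simp
    ring

variable [Algebra F K]

variable (F) in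
/-- The Carlitz map `e_j` for the parameter `T`, normalised to send `T ^ j` to `1`; it vanishes on
polynomials in `T` of degree less than `j`. The recursion is
`(T ^ (q ^ j) - T) e_j = e_{j-1} ^ q - e_{j-1}`.
The inverse is meaningful when `T ^ (q ^ i) ≠ T` for all `i > 0`, for instance if `T` is
transcendental over `F`. -/
def carlitzMap (T : K) : ℕ → K →ₗ[F] K
  | 0 => LinearMap.id
  | j + 1 => (T ^ Fintype.card F ^ (j + 1) - T)⁻¹ •
      ((FiniteField.frobeniusAlgHom F K).toLinearMap ∘ₗ carlitzMap T j - carlitzMap T j)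

theorem carlitzMap_zero (T x : K) : carlitzMap F T 0 x = x := rfl

theorem carlitzMap_succ (T x : K) (j : ℕ) :
    carlitzMap F T (j + 1) x = (T ^ Fintype.card F ^ (j + 1) - T)⁻¹ *
      (carlitzMap F T j x ^ Fintype.card F - carlitzMap F T j x) := rfl

/-- The functional equation of the Carlitz maps, from which their values at powers of `T` follow. -/
theorem carlitzMap_succ_mul {T : K} (hT : ∀ i, T ^ Fintype.card F ^ (i + 1) - T ≠ 0)
    (j : ℕ) (x : K) :
    carlitzMap F T (j + 1) (T * x) =
      T ^ Fintype.card F ^ (j + 1) * carlitzMap F T (j + 1) x + carlitzMap F T j x := by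
  induction j with
  | zero =>
    have h := hT 0
    simp only [carlitzMap_succ, carlitzMap_zero] at *
    field_simp
    simp only [zero_add, pow_one] at *
    ring
  | succ j ih =>
    have h := hT (j + 1)
    have h0 := hT j
    have hadd : ∀ a b : K, (a + b) ^ Fintype.card F = a ^ Fintype.card F + b ^ Fintype.card F :=
      fun a b ↦ map_add (FiniteField.frobeniusAlgHom F K) a b
    have hx := carlitzMap_succ (F := F) T x j
    have hx' : (T ^ Fintype.card F ^ (j + 1) - T) * carlitzMap F T (j + 1) x =
        carlitzMap F T j x ^ Fintype.card F - carlitzMap F T j x := by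
      rw [hx, mul_inv_cancel_left₀ h0]
    rw [carlitzMap_succ, ih, hadd, mul_pow, ← pow_mul, ← pow_succ, inv_mul_eq_iff_eq_mul₀ h,
      mul_add, mul_left_comm, carlitzMap_succ (F := F) T x (j + 1), mul_inv_cancel_left₀ h]
    linear_combination -hx'

theorem carlitzMap_pow {T : K} (hT : ∀ i, T ^ Fintype.card F ^ (i + 1) - T ≠ 0) (i : ℕ) :
    ∀ j, i ≤ j → carlitzMap F T j (T ^ i) = if i = j then 1 else 0 := by
  induction i with
  | zero =>
    intro j _
    rw [pow_zero]
    induction j with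
    | zero => simp [carlitzMap_zero]
    | succ j ih =>
      rw [carlitzMap_succ, ih (Nat.zero_le _)]
      split_ifs with h <;> simp_all
  | succ i ih =>
    rintro (_ | j) hj
    · omega
    · rw [pow_succ', carlitzMap_succ_mul hT, ih _ (by omega), ih _ (by omega)]
      simp [show i ≠ j + 1 by omega]

/-- On polynomials of degree at most `j`, the map `e_j` reads off the coefficient of degree `j`. -/
theorem carlitzMap_aeval {T : K} (hT : ∀ i, T ^ Fintype.card F ^ (i + 1) - T ≠ 0)
    {a : F[X]} {j : ℕ} (ha : a.natDegree ≤ j) :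
    carlitzMap F T j (aeval T a) = algebraMap F K (a.coeff j) := by
  rw [aeval_eq_sum_range' (Nat.lt_succ_of_le ha), map_sum, Finset.sum_eq_single j]
  · rw [map_smul, carlitzMap_pow hT _ _ le_rfl, if_pos rfl, Algebra.algebraMap_eq_smul_one]
  · intro i hi hij
    rw [map_smul, carlitzMap_pow hT _ _ (by simpa [Nat.lt_succ_iff] using hi), if_neg hij,
      smul_zero]
  · simp

theorem pow_eq_sum_carlitzMap {T : K} (hT : ∀ i, T ^ Fintype.card F ^ (i + 1) - T ≠ 0)
    (x : K) (i : ℕ) : ∀ D, i < D → x ^ i =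
      ∑ j ∈ Finset.range D, (∏ l ∈ Finset.range j, (x - T ^ Fintype.card F ^ l)) *
        carlitzMap F T j (T ^ i) := by
  induction i with
  | zero =>
    intro D hD
    rw [Finset.sum_eq_single 0]
    · simp [carlitzMap_zero]
    · intro j _ hj
      rw [carlitzMap_pow hT _ _ (Nat.zero_le _), if_neg hj.symm, mul_zero]
    · simp; omega
  | succ i ih =>
    rintro (_ | D) hD
    · omega
    have h1 := ih (D + 1) (by omega)
    have h2 := ih D (by omega)
    have h3 : ∀ j, (∏ l ∈ Finset.range (j + 1), (x - T ^ Fintype.card F ^ l)) *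
        carlitzMap F T (j + 1) (T ^ (i + 1)) =
        (∏ l ∈ Finset.range (j + 1), (x - T ^ Fintype.card F ^ l)) *
          T ^ Fintype.card F ^ (j + 1) * carlitzMap F T (j + 1) (T ^ i) +
        (∏ l ∈ Finset.range j, (x - T ^ Fintype.card F ^ l)) * 
          (x - T ^ Fintype.card F ^ j) * carlitzMap F T j (T ^ i) := by
      intro j
      rw [pow_succ', carlitzMap_succ_mul hT, Finset.prod_range_succ]
      ring
    have h4 : ∀ j, (∏ l ∈ Finset.range j, (x - T ^ Fintype.card F ^ l)) * 
          (x - T ^ Fintype.card F ^ j) * carlitzMap F T j (T ^ i) =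
        x * ((∏ l ∈ Finset.range j, (x - T ^ Fintype.card F ^ l)) * carlitzMap F T j (T ^ i)) -
        (∏ l ∈ Finset.range j, (x - T ^ Fintype.card F ^ l)) * T ^ Fintype.card F ^ j *
          carlitzMap F T j (T ^ i) := fun j ↦ by ring
    have h5 := Finset.sum_range_succ' (fun j ↦ (∏ l ∈ Finset.range j,
      (x - T ^ Fintype.card F ^ l)) * T ^ Fintype.card F ^ j * carlitzMap F T j (T ^ i)) D
    -- the terms of index `D` vanish because `i < D`, so the shifted sum is the full one
    have h6 : carlitzMap F T D (T ^ i) = 0 := by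
      rw [carlitzMap_pow hT _ _ (by omega), if_neg (by omega)]
    rw [Finset.sum_range_succ, h6, mul_zero, add_zero] at h5
    rw [Finset.sum_range_succ', Finset.sum_congr rfl (fun j _ ↦ h3 j), Finset.sum_add_distrib,
      Finset.sum_congr rfl (fun j _ ↦ h4 j), Finset.sum_sub_distrib, ← Finset.mul_sum, ← h2, h5]
    simp only [Finset.range_zero, Finset.prod_empty, carlitzMap_zero, pow_zero, pow_one]
    ring

/-- Carlitz' expansion of evaluation at `x` as an `F`-linear function of evaluation at `T`. -/
theorem aeval_eq_sum_carlitzMap {T : K} (hT : ∀ i, T ^ Fintype.card F ^ (i + 1) - T ≠ 0)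
    (x : K) {a : F[X]} {d : ℕ} (ha : a.natDegree ≤ d) : aeval x a =
      ∑ j ∈ Finset.range (d + 1), (∏ l ∈ Finset.range j, (x - T ^ Fintype.card F ^ l)) *
        carlitzMap F T j (aeval T a) := by
  rw [aeval_eq_sum_range' (Nat.lt_succ_of_le ha), aeval_eq_sum_range' (Nat.lt_succ_of_le ha)]
  simp_rw [map_sum, Finset.mul_sum, map_smul]
  rw [Finset.sum_comm]
  refine Finset.sum_congr rfl fun i hi ↦ ?_
  rw [pow_eq_sum_carlitzMap hT x i (d + 1) (by simpa using hi), Finset.smul_sum]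
  exact Finset.sum_congr rfl fun j _ ↦ (mul_smul_comm _ _ _).symm

theorem mul_eval_carlitzQuot (T x : K) (j : ℕ) :
    x * (carlitzQuot F T j).eval x = carlitzMap F T j x := by
  induction j with
  | zero => simp [carlitzQuot, carlitzMap_zero]
  | succ j ih =>
    have h : x ^ Fintype.card F = x * x ^ (Fintype.card F - 1) :=
      (mul_pow_sub_one Fintype.card_ne_zero x).symm
    rw [carlitzMap_succ, ← ih, mul_pow, h, carlitzQuot]
    simp only [eval_mul, eval_C, eval_sub, eval_pow, eval_X]
    ring

theorem mul_eval_interpQuot {T : K} (hT : ∀ i, T ^ Fintype.card F ^ (i + 1) - T ≠ 0)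
    (x : K) {a : F[X]} {d : ℕ} (ha : a.natDegree ≤ d) :
    aeval T a * (interpQuot F T x d).eval (aeval T a) = aeval x a := by
  rw [aeval_eq_sum_carlitzMap hT x ha, interpQuot, eval_finsetSum, Finset.mul_sum]
  refine Finset.sum_congr rfl fun j _ ↦ ?_
  rw [eval_mul, eval_C, mul_left_comm, mul_eval_carlitzQuot]

end Carlitz

/-! ### Power sums over additive groups and over monic polynomials -/

section Sums

variable {F K : Type*} [Field F] [Fintype F] [Field K] [Algebra F K]

/-- By Lagrange interpolation, the coefficient of degree `|G| - 1` of `P` is the sum of the values of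
`P` on `G` weighted by the inverses of `∏_{h ≠ g} (v g - v h)`, and this weight does not depend on
`g`. -/
theorem sum_eval_eq_zero {G : Type*} [AddCommGroup G] [Fintype G] (v : G →+ K)
    (hv : Function.Injective v) (P : K[X]) (hP : P.natDegree + 1 < Fintype.card G) :
    ∑ g, P.eval (v g) = 0 := by
  classical
  have hdeg : P.degree < (Finset.univ : Finset G).card := by
    refine degree_le_natDegree.trans_lt ?_
    rw [Finset.card_univ]
    exact_mod_cast (by omega : P.natDegree < Fintype.card G)
  have h := Lagrange.coeff_eq_sum (s := Finset.univ) (v := v) hv.injOn hdeg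
  rw [coeff_eq_zero_of_natDegree_lt (by rw [Finset.card_univ]; omega)] at h
  have hc : ∀ i : G, ∏ j ∈ Finset.univ.erase i, (v i - v j) =
      ∏ j ∈ Finset.univ.erase (0 : G), v j := by
    intro i
    refine Finset.prod_nbij' (fun j ↦ i - j) (fun j ↦ i - j) ?_ ?_ ?_ ?_ ?_
    · intro j hj
      simpa [sub_eq_zero, eq_comm] using hj
    · intro j hj
      simpa using hj
    · intro j _; simp
    · intro j _; simp
    · intro j _; simp
  have hc0 : ∏ j ∈ Finset.univ.erase (0 : G), v j ≠ 0 := by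
    refine Finset.prod_ne_zero_iff.2 fun j hj ↦ ?_
    rw [Ne, map_eq_zero_iff v hv]
    simpa using hj
  simp_rw [hc, ← Finset.sum_div] at h
  exact (div_eq_zero_iff.1 h.symm).resolve_right hc0

instance (D : ℕ) : Finite (degreeLT F D) :=
  Finite.of_equiv _ (degreeLTEquiv F D).toEquiv.symm

instance (D : ℕ) : Fintype (degreeLT F D) := Fintype.ofFinite _

theorem card_degreeLT (D : ℕ) : Fintype.card (degreeLT F D) = Fintype.card F ^ D := by
  rw [Fintype.card_congr (degreeLTEquiv F D).toEquiv]
  simp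

theorem mem_monicsOfDegree {d : ℕ} {a : F[X]} :
    a ∈ monicsOfDegree F d ↔ a.Monic ∧ a.natDegree = d := by
  simp [monicsOfDegree]

/-- The nonzero polynomials of degree less than `D` are the multiples by the `q - 1` nonzero
constants of the monic ones, and `q - 1 = -1` in `K`. -/
theorem sum_degreeLT_eq (f : F[X] → K) (hf : ∀ (c : F) (a : F[X]), c ≠ 0 → f (C c * a) = f a)
    (D : ℕ) : ∑ a : degreeLT F D, f a =
      f 0 - ∑ d ∈ Finset.range D, ∑ a ∈ monicsOfDegree F d, f a := by
  classical
  have hcast : ((Fintype.card Fˣ : ℕ) : K) = -1 := by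
    rw [Fintype.card_units, Nat.cast_sub Fintype.card_pos, Nat.cast_one,
      ← map_natCast (algebraMap F K), FiniteField.cast_card_eq_zero, map_zero, zero_sub]
  have h1 : ∑ a ∈ Finset.univ.erase (0 : degreeLT F D), f a =
      ∑ x ∈ ((Finset.range D).sigma fun d ↦ monicsOfDegree F d) ×ˢ (Finset.univ : Finset Fˣ),
        f x.1.2 := by
    symm
    have hmem : ∀ x ∈ ((Finset.range D).sigma fun d ↦ monicsOfDegree F d) ×ˢ
        (Finset.univ : Finset Fˣ), C (x.2 : F) * x.1.2 ∈ degreeLT F D := by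
      rintro ⟨⟨d, a⟩, c⟩ hx
      simp only [Finset.mem_product, Finset.mem_sigma, Finset.mem_range, mem_monicsOfDegree,
        Finset.mem_univ, and_true] at hx
      obtain ⟨hd, ha, rfl⟩ := hx
      rw [mem_degreeLT, degree_C_mul c.ne_zero]
      exact degree_le_natDegree.trans_lt (by exact_mod_cast hd)
    refine Finset.sum_bij (fun x hx ↦ ⟨C (x.2 : F) * x.1.2, hmem x hx⟩) ?_ ?_ ?_ ?_
    · rintro ⟨⟨d, a⟩, c⟩ hx
      simp only [Finset.mem_product, Finset.mem_sigma, Finset.mem_range, mem_monicsOfDegree,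
        Finset.mem_univ, and_true] at hx
      simpa [Subtype.ext_iff] using hx.2.1.ne_zero
    · rintro ⟨⟨d, a⟩, c⟩ hx ⟨⟨d', a'⟩, c'⟩ hx' h
      simp only [Finset.mem_product, Finset.mem_sigma, Finset.mem_range, mem_monicsOfDegree,
        Finset.mem_univ, and_true] at hx hx'
      obtain ⟨-, ha, rfl⟩ := hx
      obtain ⟨-, ha', rfl⟩ := hx'
      simp only [Subtype.mk.injEq] at h
      have hc : (c : F) = c' := by
        have := congrArg leadingCoeff h
        simpa [leadingCoeff_mul, ha.leadingCoeff, ha'.leadingCoeff] using this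
      rw [hc] at h
      obtain rfl := mul_left_cancel₀ (C_ne_zero.2 c'.ne_zero) h
      obtain rfl := Units.ext hc
      rfl
    · rintro ⟨b, hb⟩ hb0
      have hb0 : b ≠ 0 := by simpa [Subtype.ext_iff] using hb0
      have hlc : b.leadingCoeff ≠ 0 := leadingCoeff_ne_zero.2 hb0
      have hmon : (C b.leadingCoeff⁻¹ * b).Monic := by
        rw [Monic, leadingCoeff_mul, leadingCoeff_C, inv_mul_cancel₀ hlc]
      refine ⟨⟨⟨b.natDegree, C b.leadingCoeff⁻¹ * b⟩, Units.mk0 _ hlc⟩, ?_, ?_⟩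
      · simp only [Finset.mem_product, Finset.mem_sigma, Finset.mem_range, mem_monicsOfDegree,
          Finset.mem_univ, and_true]
        refine ⟨(natDegree_lt_iff_degree_lt hb0).2 (mem_degreeLT.1 hb), hmon, ?_⟩
        rw [natDegree_C_mul (inv_ne_zero hlc)]
      · simp only [Units.val_mk0, Subtype.mk.injEq]
        rw [← mul_assoc, ← C_mul, mul_inv_cancel₀ hlc, C_1, one_mul]
    · rintro ⟨⟨d, a⟩, c⟩ _
      exact (hf c a c.ne_zero).symm
  rw [← Finset.add_sum_erase _ _ (Finset.mem_univ (0 : degreeLT F D)), h1, Finset.sum_product]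
  simp only [Finset.sum_const, Finset.card_univ, nsmul_eq_mul, hcast, Finset.sum_sigma,
    neg_one_mul, Finset.sum_neg_distrib, ZeroMemClass.coe_zero]
  ring

/-- Summing a product of at most `q` polynomials of degree at most `q ^ d - 1` over all points `v a`,
`deg a ≤ d`, gives `0`; separating the point `0` leaves minus the sum over monic `a`. -/
theorem sum_monic_prod_eval {ι : Type*} [Fintype ι] (v : F[X] →ₗ[F] K)
    (hv : Function.Injective v) (d : ℕ) (L : ι → K[X]) (hι : Fintype.card ι ≤ Fintype.card F)
    (hL : ∀ i, (L i).natDegree ≤ Fintype.card F ^ d - 1)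
    (f : F[X] → K) (hf : ∀ (c : F) (a : F[X]), c ≠ 0 → f (C c * a) = f a)
    (hfL : ∀ a : F[X], a.natDegree ≤ d → a ≠ 0 → f a = ∏ i, (L i).eval (v a)) :
    ∑ j ∈ Finset.range (d + 1), ∑ a ∈ monicsOfDegree F j, f a = ∏ i, (L i).eval 0 := by
  classical
  -- `f 0` is unrelated to the value of the product at `0`, so `f` is corrected there
  set g : F[X] → K := fun a ↦ if a = 0 then ∏ i, (L i).eval 0 else f a with hg
  have hgc : ∀ (c : F) (a : F[X]), c ≠ 0 → g (C c * a) = g a := by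
    intro c a hc
    simp [hg, hc, hf c a hc]
  have h1 := sum_degreeLT_eq g hgc (d + 1)
  have hq : 1 < Fintype.card F := Fintype.one_lt_card
  have h2 : ∑ a : degreeLT F (d + 1), g a = 0 := by
    have hdeg : (∏ i, L i).natDegree + 1 < Fintype.card (degreeLT F (d + 1)) := by
      have h3 : (∏ i, L i).natDegree ≤ Fintype.card F * (Fintype.card F ^ d - 1) := by
        refine (natDegree_prod_le _ _).trans ((Finset.sum_le_card_nsmul _ _ _
          fun i _ ↦ hL i).trans ?_)
        rw [smul_eq_mul, Finset.card_univ]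
        exact Nat.mul_le_mul_right _ hι
      have h4 : Fintype.card F ≤ Fintype.card F * Fintype.card F ^ d :=
        Nat.le_mul_of_pos_right _ (pow_pos (by omega) _)
      rw [card_degreeLT, pow_succ']
      rw [Nat.mul_sub, mul_one] at h3
      omega
    rw [← sum_eval_eq_zero (v ∘ₗ (degreeLT F (d + 1)).subtype).toAddMonoidHom
      (hv.comp Subtype.val_injective) _ hdeg]
    refine Finset.sum_congr rfl fun a _ ↦ ?_
    simp only [hg, eval_prod]
    split_ifs with ha
    · refine Finset.prod_congr rfl fun i _ ↦ ?_
      simp [ha]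
    · refine hfL a ?_ ha
      exact Nat.lt_succ_iff.1 ((natDegree_lt_iff_degree_lt ha).2 (mem_degreeLT.1 a.2))
  rw [h2, eq_comm, sub_eq_zero] at h1
  rw [show ∏ i, (L i).eval 0 = g 0 by simp [hg], h1]
  refine Finset.sum_congr rfl fun j _ ↦ Finset.sum_congr rfl fun a ha ↦ ?_
  simp [hg, (mem_monicsOfDegree.1 ha).1.ne_zero]

end Sums

/-! ### Explicit power sums in `F(t)` -/

section PowerSum

variable {F : Type*} [Field F]

theorem aeval_ratFuncX (a : F[X]) :
    aeval (RatFunc.X : RatFunc F) a = algebraMap F[X] (RatFunc F) a := by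
  rw [← RatFunc.algebraMap_X, aeval_algebraMap_apply, aeval_X_left_apply]

theorem X_pow_sub_X_pow_ne_zero {m n : ℕ} (h : m ≠ n) :
    (RatFunc.X ^ m - RatFunc.X ^ n : RatFunc F) ≠ 0 := by
  rw [sub_ne_zero, ← RatFunc.algebraMap_X, ← map_pow, ← map_pow, Ne,
    (RatFunc.algebraMap_injective F).eq_iff]
  intro h'
  exact h (by simpa using congrArg natDegree h')

variable [Fintype F]

theorem frobeniusAlgHom_pow_apply {K : Type*} [Field K] [Algebra F K] (k : ℕ) (x : K) :
    (FiniteField.frobeniusAlgHom F K ^ k) x = x ^ Fintype.card F ^ k := by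
  induction k with
  | zero => simp
  | succ k ih => rw [pow_succ', AlgHom.mul_apply, ih, pow_succ, pow_mul]; rfl

theorem sub_pow_card_pow {K : Type*} [Field K] [Algebra F K] (k : ℕ) (x y : K) :
    (x - y) ^ Fintype.card F ^ k = x ^ Fintype.card F ^ k - y ^ Fintype.card F ^ k := by
  simp only [← frobeniusAlgHom_pow_apply, map_sub]

theorem aeval_pow_card_pow {K : Type*} [Field K] [Algebra F K] (k : ℕ) (x : K) (a : F[X]) :
    aeval (x ^ Fintype.card F ^ k) a = aeval x a ^ Fintype.card F ^ k := by
  simp only [← frobeniusAlgHom_pow_apply, aeval_algHom_apply]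

theorem bracket_eq (n : ℕ) :
    -bracket F n = RatFunc.X - RatFunc.X ^ Fintype.card F ^ n := by
  rw [bracket]; ring

theorem bracket_ne_zero (n : ℕ) : bracket F (n + 1) ≠ 0 := by
  have := X_pow_sub_X_pow_ne_zero (F := F) (m := Fintype.card F ^ (n + 1)) (n := 1)
    (Nat.one_lt_pow (by omega) Fintype.one_lt_card).ne'
  simpa [bracket] using this

theorem ell_zero : ell F 0 = 1 := by simp [ell]

theorem ell_succ (n : ℕ) : ell F (n + 1) = ell F n * -bracket F (n + 1) := by
  rw [ell, Finset.prod_Icc_succ_top (by omega), bracket_eq]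
  rfl

theorem ell_one : ell F 1 = -bracket F 1 := by rw [ell_succ, ell_zero, one_mul]

theorem ell_ne_zero (n : ℕ) : ell F n ≠ 0 := by
  induction n with
  | zero => simp [ell_zero]
  | succ n ih => rw [ell_succ]; exact mul_ne_zero ih (neg_ne_zero.2 (bracket_ne_zero n))

theorem prod_X_sub (n d : ℕ) :
    ∏ i ∈ Finset.Icc 1 d, (RatFunc.X - RatFunc.X ^ Fintype.card F ^ (n + i)) =
      ell F (n + d) / ell F n := by
  induction d with
  | zero => simp [ell_ne_zero]
  | succ d ih =>
    rw [Finset.prod_Icc_succ_top (by omega), ih, ← bracket_eq, ← add_assoc, ell_succ]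
    ring

theorem X_pow_card_ne (N i : ℕ) : ((RatFunc.X ^ Fintype.card F ^ N : RatFunc F) ^
    Fintype.card F ^ (i + 1) - RatFunc.X ^ Fintype.card F ^ N) ≠ 0 := by
  rw [← pow_mul]
  refine X_pow_sub_X_pow_ne_zero fun h ↦ ?_
  have h1 : 1 < Fintype.card F ^ (i + 1) := Nat.one_lt_pow (by omega) Fintype.one_lt_card
  have h2 : 0 < Fintype.card F ^ N := pow_pos Fintype.card_pos _
  exact (lt_mul_of_one_lt_right h2 h1).ne' h

variable (F) in
/-- The product `∏_{i=1}^d (t ^ (q ^ k) - t ^ (q ^ (N + i)))`, in the form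
`(ℓ_{N-k+d} / ℓ_{N-k}) ^ (q ^ k)`. The subtraction is truncated: only `k ≤ N` is meaningful. -/
def ellQuot (N d k : ℕ) : RatFunc F :=
  (ell F (N - k + d) / ell F (N - k)) ^ Fintype.card F ^ k

theorem eval_zero_interpQuot_ratFunc {N k : ℕ} (hk : k ≤ N) (d : ℕ) :
    (interpQuot F (RatFunc.X ^ Fintype.card F ^ N : RatFunc F)
      (RatFunc.X ^ Fintype.card F ^ k) d).eval 0 =
      ellQuot F N d k / ell F d ^ Fintype.card F ^ N := by
  rw [eval_zero_interpQuot (X_pow_card_ne N), Finset.prod_div_distrib]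
  congr 1
  · rw [ellQuot, ← prod_X_sub, ← Finset.prod_pow]
    refine Finset.prod_congr rfl fun i _ ↦ ?_
    rw [sub_pow_card_pow, ← pow_mul, ← pow_mul, ← pow_add, ← pow_add]
    congr 3
    omega
  · rw [ell, ← Finset.prod_pow]
    refine Finset.prod_congr rfl fun i _ ↦ ?_
    rw [sub_pow_card_pow, ← pow_mul, ← pow_mul, mul_comm]

theorem eval_zero_carlitzQuot_ratFunc (N d : ℕ) :
    (carlitzQuot F (RatFunc.X ^ Fintype.card F ^ N : RatFunc F) d).eval 0 =
      1 / ell F d ^ Fintype.card F ^ N := by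
  rw [eval_zero_carlitzQuot, Finset.prod_inv_distrib, one_div, ell, ← Finset.prod_pow]
  congr 1
  refine Finset.prod_congr rfl fun i _ ↦ ?_
  rw [sub_pow_card_pow, ← pow_mul, ← pow_mul, mul_comm]

theorem aeval_X_pow_card_pow (k : ℕ) (a : F[X]) :
    aeval (RatFunc.X ^ Fintype.card F ^ k : RatFunc F) a =
      algebraMap F[X] (RatFunc F) a ^ Fintype.card F ^ k := by
  rw [aeval_pow_card_pow, aeval_ratFuncX]

/-- The effect of a constant `c` on the exponents: `c ^ q = c` in `F`. -/
theorem pow_mul_pow_card_eq_pow {ι : Type*} [Fintype ι] {k : ι → ℕ} {N m e : ℕ}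
    (he : e + ∑ i, Fintype.card F ^ k i = m * Fintype.card F ^ N) (c : F) :
    c ^ e * c ^ Fintype.card ι = c ^ m := by
  have h := congrArg (c ^ ·) he
  simp only [pow_add] at h
  rw [← Finset.prod_pow_eq_pow_sum] at h
  simpa [FiniteField.pow_card_pow, mul_comm m, pow_mul] using h

theorem one_div_pow_eq_prod {ι : Type*} [Fintype ι] {k : ι → ℕ} {N m e : ℕ}
    (he : e + ∑ i, Fintype.card F ^ k i = m * Fintype.card F ^ N) {x : RatFunc F} (hx : x ≠ 0) :
    1 / x ^ e = (∏ i, x ^ Fintype.card F ^ k i) / (x ^ Fintype.card F ^ N) ^ m := by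
  rw [Finset.prod_pow_eq_pow_sum, ← pow_mul, mul_comm _ m, ← he, pow_add]
  field_simp

theorem aeval_X_pow_injective (N : ℕ) : Function.Injective
    (aeval (RatFunc.X ^ Fintype.card F ^ N : RatFunc F) : F[X] →ₐ[F] RatFunc F).toLinearMap := by
  rw [← LinearMap.ker_eq_bot, LinearMap.ker_eq_bot']
  intro a ha
  have ha : aeval (RatFunc.X ^ Fintype.card F ^ N : RatFunc F) a = 0 := ha
  rw [aeval_X_pow_card_pow] at ha
  simpa using eq_zero_of_pow_eq_zero ha

/-- The common source of `sum_powerSum` (`r = 0`) and `powerSum_eq` (`r > 0`, where the power of the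
coefficient of degree `d` removes all monic polynomials of degree less than `d`). -/
theorem sum_coeff_pow_div_pow {ι : Type*} [Fintype ι] {k : ι → ℕ} {N r e : ℕ}
    (hk : ∀ i, k i ≤ N) (hm : Fintype.card ι + r ≤ Fintype.card F)
    (he : e + ∑ i, Fintype.card F ^ k i = (Fintype.card ι + r) * Fintype.card F ^ N) (d : ℕ) :
    ∑ j ∈ Finset.range (d + 1), ∑ a ∈ monicsOfDegree F j,
      algebraMap F (RatFunc F) (a.coeff d) ^ r / algebraMap F[X] (RatFunc F) a ^ e =
      (∏ i, ellQuot F N d (k i)) / (ell F d ^ Fintype.card F ^ N) ^ (Fintype.card ι + r) := by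
  classical
  have key := sum_monic_prod_eval _ (aeval_X_pow_injective N) d
    (Sum.elim (fun i : ι ↦ interpQuot F (RatFunc.X ^ Fintype.card F ^ N : RatFunc F)
      (RatFunc.X ^ Fintype.card F ^ k i) d) (fun _ : Fin r ↦
        carlitzQuot F (RatFunc.X ^ Fintype.card F ^ N : RatFunc F) d))
    (by simpa using hm) (by
      rintro (i | i)
      · exact natDegree_interpQuot _ _ _
      · exact natDegree_carlitzQuot _ _)
    (fun a ↦ algebraMap F (RatFunc F) (a.coeff d) ^ r / algebraMap F[X] (RatFunc F) a ^ e)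
      ?_ ?_
  · rw [key, Fintype.prod_sum_type]
    simp only [Sum.elim_inl, Sum.elim_inr, eval_zero_carlitzQuot_ratFunc,
      eval_zero_interpQuot_ratFunc (hk _), Finset.prod_div_distrib, Finset.prod_const,
      Finset.card_univ, Fintype.card_fin, one_pow]
    rw [div_mul_div_comm, mul_one, ← pow_add]
  · intro c a hc
    have h1 := pow_mul_pow_card_eq_pow he c
    have h2 : c ^ e = c ^ r := by
      refine mul_right_cancel₀ (pow_ne_zero (Fintype.card ι) hc) (h1.trans ?_)
      rw [← pow_add]
      congr 1
      omega
    have hc' : algebraMap F (RatFunc F) c ^ r ≠ 0 := by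
      exact pow_ne_zero _ (by simpa using hc)
    rw [map_mul, coeff_C_mul, map_mul, mul_pow, mul_pow, ← map_pow (algebraMap F[X] (RatFunc F)),
      ← C_pow, h2, C_pow, map_pow, ← Polynomial.algebraMap_eq,
      ← IsScalarTower.algebraMap_apply F F[X] (RatFunc F), mul_div_mul_left _ _ hc']
  · intro a hda ha
    have ha' : algebraMap F[X] (RatFunc F) a ≠ 0 := by simpa using ha
    have h3 : algebraMap F (RatFunc F) (a.coeff d) ^ r / algebraMap F[X] (RatFunc F) a ^ e =
        algebraMap F (RatFunc F) (a.coeff d) ^ r * (1 / algebraMap F[X] (RatFunc F) a ^ e) :=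
      by ring
    have h4 : ∀ i, (interpQuot F (RatFunc.X ^ Fintype.card F ^ N : RatFunc F)
        (RatFunc.X ^ Fintype.card F ^ k i) d).eval
          (algebraMap F[X] (RatFunc F) a ^ Fintype.card F ^ N) =
        algebraMap F[X] (RatFunc F) a ^ Fintype.card F ^ k i /
          algebraMap F[X] (RatFunc F) a ^ Fintype.card F ^ N := by
      intro i
      have h := mul_eval_interpQuot (X_pow_card_ne N) (RatFunc.X ^ Fintype.card F ^ k i) hda
      rw [eq_div_iff (pow_ne_zero _ ha'), mul_comm]
      simpa only [aeval_X_pow_card_pow] using h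
    have h5 : (carlitzQuot F (RatFunc.X ^ Fintype.card F ^ N : RatFunc F) d).eval
          (algebraMap F[X] (RatFunc F) a ^ Fintype.card F ^ N) =
        algebraMap F (RatFunc F) (a.coeff d) /
          algebraMap F[X] (RatFunc F) a ^ Fintype.card F ^ N := by
      rw [eq_div_iff (pow_ne_zero _ ha'), mul_comm, mul_eval_carlitzQuot (F := F),
        ← aeval_X_pow_card_pow, carlitzMap_aeval (X_pow_card_ne N) hda]
    rw [h3, one_div_pow_eq_prod he ha', Fintype.prod_sum_type]
    simp only [Sum.elim_inl, Sum.elim_inr, AlgHom.toLinearMap_apply, aeval_X_pow_card_pow, h4, h5,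
      Finset.prod_div_distrib, Finset.prod_const, Finset.card_univ, Fintype.card_fin]
    rw [div_mul_div_comm, ← pow_add, mul_div_assoc', mul_comm]

/-- The value of `S_{<d+1}(e)` for `e = m q ^ N - ∑ q ^ k_i`, with `m ≤ q` terms in the sum. -/
theorem sum_powerSum {ι : Type*} [Fintype ι] {k : ι → ℕ} {N m e : ℕ} (hk : ∀ i, k i ≤ N)
    (hι : Fintype.card ι = m) (hm : m ≤ Fintype.card F)
    (he : e + ∑ i, Fintype.card F ^ k i = m * Fintype.card F ^ N) (d : ℕ) :
    ∑ j ∈ Finset.range (d + 1), powerSum F j e =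
      (∏ i, ellQuot F N d (k i)) / (ell F d ^ Fintype.card F ^ N) ^ m := by
  subst hι
  have h := sum_coeff_pow_div_pow (r := 0) hk hm he d
  simp only [pow_zero, add_zero] at h
  exact h

/-- The value of `S_d(e)` for `e = m q ^ N - ∑ q ^ k_i`, with fewer than `m ≤ q` terms in the sum. -/
theorem powerSum_eq {ι : Type*} [Fintype ι] {k : ι → ℕ} {N m e : ℕ} (hk : ∀ i, k i ≤ N)
    (hι : Fintype.card ι < m) (hm : m ≤ Fintype.card F)
    (he : e + ∑ i, Fintype.card F ^ k i = m * Fintype.card F ^ N) (d : ℕ) :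
    powerSum F d e = (∏ i, ellQuot F N d (k i)) / (ell F d ^ Fintype.card F ^ N) ^ m := by
  obtain ⟨r, rfl⟩ := Nat.exists_eq_add_of_lt hι
  rw [add_assoc] at hm he ⊢
  rw [← sum_coeff_pow_div_pow hk hm he d, Finset.sum_range_succ, Finset.sum_eq_zero, zero_add]
  · refine Finset.sum_congr rfl fun a ha ↦ ?_
    obtain ⟨hmon, rfl⟩ := mem_monicsOfDegree.1 ha
    rw [hmon.coeff_natDegree, map_one, one_pow]
  · intro j hj
    refine Finset.sum_eq_zero fun a ha ↦ ?_
    obtain ⟨ha, rfl⟩ := mem_monicsOfDegree.1 ha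
    rw [coeff_eq_zero_of_natDegree_lt (by simpa using hj), map_zero, zero_pow (by omega),
      zero_div]

theorem powerSum_card_pow (d M : ℕ) :
    powerSum F d (Fintype.card F ^ M) = 1 / ell F d ^ Fintype.card F ^ M := by
  rw [powerSum_eq (ι := Fin 0) (k := Fin.elim0) (N := M) (m := 1) (fun i ↦ i.elim0) (by simp)
    Fintype.card_pos (by simp)]
  simp

theorem neg_pow_card_pow {K : Type*} [Field K] [Algebra F K] (k : ℕ) (x : K) :
    (-x) ^ Fintype.card F ^ k = -x ^ Fintype.card F ^ k := by
  simp only [← frobeniusAlgHom_pow_apply, map_neg]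

end PowerSum

/-! ### Convergence at the infinite place -/

section Convergence


theorem nonarchimedeanAddGroup_of_valued {R Γ₀ : Type*} [Ring R]
    [LinearOrderedCommGroupWithZero Γ₀] [Valued R Γ₀] : NonarchimedeanAddGroup R where
  is_nonarchimedean U hU := by
    obtain ⟨γ, hγ⟩ := Valued.mem_nhds_zero.1 hU
    refine ⟨⟨Valued.v.ltAddSubgroup (Units.map
      (MonoidWithZeroHom.ValueGroup₀.embedding (f := (.ofClass (Valued.v (R := R))))) γ), ?_⟩, ?_⟩
    · have := Valued.isOpen_ball R
        (γ : MonoidWithZeroHom.ValueGroup₀ (.ofClass (Valued.v (R := R))))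
      convert this using 1
      ext x
      simp [Valuation.restrict_lt_iff_lt_embedding]
    · intro x hx
      exact hγ ((Valuation.restrict_lt_iff_lt_embedding _).2 hx)

variable {F : Type*} [Field F] [DecidableEq (RatFunc F)]

instance : CompleteSpace (RatFunc.CompletionAtInfty F) :=
  letI := RatFunc.inftyValued F
  inferInstanceAs (CompleteSpace (UniformSpace.Completion (RatFunc F)))

theorem valued_algebraMap (x : RatFunc F) :
    Valued.v (algebraMap (RatFunc F) (RatFunc.CompletionAtInfty F) x) =
      RatFunc.inftyValuation F x :=
  letI := RatFunc.inftyValued F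
  Valued.valuedCompletion_apply x

instance : NonarchimedeanAddGroup (RatFunc.CompletionAtInfty F) :=
  nonarchimedeanAddGroup_of_valued

theorem summable_of_valuation_le {α : Type*} (f : α → RatFunc.CompletionAtInfty F) (w : α → ℕ)
    (hw : ∀ n, {i | w i ≤ n}.Finite) (hf : ∀ i, Valued.v (f i) ≤ exp (-(w i : ℤ))) :
    Summable f := by
  refine NonarchimedeanAddGroup.summable_of_tendsto_cofinite_zero ?_
  rw [(Valued.hasBasis_nhds_zero (RatFunc.CompletionAtInfty F) ℤᵐ⁰).tendsto_right_iff]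
  intro γ _
  set g := MonoidWithZeroHom.ValueGroup₀.embedding
    (f := .ofClass (Valued.v (R := RatFunc.CompletionAtInfty F))) γ with hg
  have hg0 : g ≠ 0 := by rw [hg, Ne, map_eq_zero]; exact γ.ne_zero
  refine (hw (-log g).toNat).subset fun i hi ↦ ?_
  have hi : ¬ Valued.v (f i) < g := fun h ↦ hi ((Valuation.restrict_lt_iff_lt_embedding _).2 h)
  have h1 := (not_lt.1 hi).trans (hf i)
  rw [← log_le_iff_le_exp hg0] at h1
  simp only [Set.mem_ofPred_eq]
  omega

theorem valuation_powerSum [Fintype F] (d s : ℕ) :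
    RatFunc.inftyValuation F (powerSum F d s) ≤ exp (-((d * s : ℕ) : ℤ)) := by
  refine Valuation.map_sum_le _ fun a ha ↦ ?_
  obtain ⟨hmon, rfl⟩ := mem_monicsOfDegree.1 ha
  rw [map_div₀, map_one, map_pow, RatFunc.inftyValuation_apply,
    RatFunc.inftyValuation.polynomial _ hmon.ne_zero, one_div, ← exp_nsmul, ← exp_neg]
  simp [mul_comm]

theorem summable_multizetaTerm [Fintype F] {r : ℕ} (s : Fin r → ℕ) (hs : ∀ i, 0 < s i) :
    Summable (multizetaTerm F s) := by
  refine summable_of_valuation_le _ (fun d ↦ ∑ i, d.1 i) (fun n ↦ ?_) fun d ↦ ?_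
  · refine Set.Finite.of_finite_image (f := Subtype.val)
      ((Set.finite_Iic (fun _ ↦ n : Fin r → ℕ)).subset ?_) Subtype.val_injective.injOn
    rintro _ ⟨d, hd, rfl⟩ i
    exact (Finset.single_le_sum (f := d.1) (fun _ _ ↦ Nat.zero_le _) (Finset.mem_univ i)).trans hd
  · rw [multizetaTerm, valued_algebraMap, map_prod]
    calc ∏ i, RatFunc.inftyValuation F (powerSum F (d.1 i) (s i))
        ≤ ∏ i, exp (-(d.1 i : ℤ)) := by
          refine Finset.prod_le_prod' fun i _ ↦ (valuation_powerSum _ _).trans ?_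
          rw [exp_le_exp, neg_le_neg_iff, Nat.cast_le]
          exact Nat.le_mul_of_pos_right _ (hs i)
      _ = exp (-((∑ i, d.1 i : ℕ) : ℤ)) := by
          induction (Finset.univ : Finset (Fin r)) using Finset.cons_induction with
          | empty => simp
          | cons i S hi ih =>
            rw [Finset.prod_cons, Finset.sum_cons, ih, Nat.cast_add, neg_add, exp_add]

variable (F) in
theorem hasSum_multizeta_one [Fintype F] {w : ℕ} (hw : 0 < w) :
    HasSum (fun d ↦ algebraMap (RatFunc F) (RatFunc.CompletionAtInfty F) (powerSum F d w))
      (multizeta F ![w]) := by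
  let e : {d : Fin 1 → ℕ // StrictAnti d} ≃ ℕ :=
    { toFun := fun d ↦ d.1 0
      invFun := fun n ↦ ⟨fun _ ↦ n, Subsingleton.strictAnti _⟩
      left_inv := fun d ↦ by ext i; simp [Subsingleton.elim i 0]
      right_inv := fun n ↦ rfl }
  have h := (summable_multizetaTerm (F := F) ![w] (by simpa using hw)).hasSum
  rw [← e.symm.hasSum_iff] at h
  convert! h using 2 with d
  simp [multizetaTerm, e]

variable (F) in
theorem hasSum_multizeta_two [Fintype F] {a b : ℕ} (ha : 0 < a) (hb : 0 < b) :
    HasSum (fun d ↦ algebraMap (RatFunc F) (RatFunc.CompletionAtInfty F)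
      (powerSum F d a * ∑ j ∈ Finset.range d, powerSum F j b)) (multizeta F ![a, b]) := by
  let e : {d : Fin 2 → ℕ // StrictAnti d} ≃ Σ n : ℕ, Fin n :=
    { toFun := fun d ↦ ⟨d.1 0, d.1 1, d.2 (by simp)⟩
      invFun := fun n ↦ ⟨![n.1, n.2], by
        intro i j hij
        have hi : i = 0 := by omega
        have hj : j = 1 := by omega
        subst hi hj
        simp⟩
      left_inv := fun d ↦ by ext i; fin_cases i <;> rfl
      right_inv := fun n ↦ rfl }
  have h := (summable_multizetaTerm (F := F) ![a, b] (by
    intro i; fin_cases i <;> simpa)).hasSum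
  rw [← e.symm.hasSum_iff] at h
  convert! h.sigma (fun d ↦ hasSum_fintype _) using 2 with d
  rw [Finset.mul_sum, map_sum, Finset.sum_range]
  refine Finset.sum_congr rfl fun j _ ↦ ?_
  rw [Function.comp_apply, multizetaTerm, Fin.prod_univ_two]
  rfl

/-- The term of `ζ(a, b)` with `d₁ = 0` vanishes, so the identity follows from comparing the terms
with `d₁ = d + 1` on the left with those of `d` on the right. -/
theorem multizeta_eq_smul_of_telescope [Fintype F] {a b w : ℕ} (ha : 0 < a) (hb : 0 < b)
    (hw : 0 < w) (c : RatFunc F) (v : ℕ → RatFunc F) (hv0 : v 0 = 0)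
    (hv : Tendsto (fun d ↦ algebraMap (RatFunc F) (RatFunc.CompletionAtInfty F) (v d))
      atTop (𝓝 0))
    (h : ∀ d, powerSum F (d + 1) a * ∑ j ∈ Finset.range (d + 1), powerSum F j b =
      c * powerSum F d w + (v (d + 1) - v d)) :
    multizeta F ![a, b] = c • multizeta F ![w] := by
  have h1 := hasSum_multizeta_two F ha hb
  rw [← hasSum_nat_add_iff' 1] at h1
  simp only [h, Finset.range_one, Finset.sum_singleton, Finset.range_zero, Finset.sum_empty,
    mul_zero, map_zero, sub_zero] at h1
  have h2 := (hasSum_multizeta_one F hw).mul_left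
    (algebraMap (RatFunc F) (RatFunc.CompletionAtInfty F) c)
  have h3 := h1.sub h2
  simp only [map_add, map_mul, map_sub, add_sub_cancel_left] at h3
  have h4 := h3.tendsto_sum_nat
  have h5 (n : ℕ) := Finset.sum_range_sub
    (fun d ↦ algebraMap (RatFunc F) (RatFunc.CompletionAtInfty F) (v d)) n
  simp only [h5, hv0, map_zero, sub_zero] at h4
  rw [Algebra.smul_def, ← sub_eq_zero]
  exact tendsto_nhds_unique h4 hv

theorem multizeta_eq_smul [Fintype F] {a b w : ℕ} (ha : 0 < a) (hb : 0 < b)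
    (hw : 0 < w) (c : RatFunc F)
    (h : ∀ d, powerSum F (d + 1) a * ∑ j ∈ Finset.range (d + 1), powerSum F j b =
      c * powerSum F d w) :
    multizeta F ![a, b] = c • multizeta F ![w] :=
  multizeta_eq_smul_of_telescope ha hb hw c (fun _ ↦ 0) rfl (by simp) (by simpa using h)

/-- The telescoping sequence is `v (d + 1) = -c S_d(w)`: by `[d+2] = [2] + [d] ^ (q ^ 2)`, what has
to be summed is `-c (1 + [d] ^ w) S_d(w)`, where `w = q ^ (e + 2)` and `[d] ^ w S_d(w) = -S_{d-1}(w)`. -/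
theorem multizeta_eq_smul_of_bracket [Fintype F] {a b w : ℕ} (ha : 0 < a) (hb : 0 < b) (e : ℕ)
    (hw : w = Fintype.card F ^ (e + 2)) (c : RatFunc F)
    (h : ∀ d, powerSum F (d + 1) a * ∑ j ∈ Finset.range (d + 1), powerSum F j b =
      c * -bracket F (d + 2) ^ Fintype.card F ^ e * powerSum F d w) :
    multizeta F ![a, b] = (c * (1 - bracket F 2 ^ Fintype.card F ^ e)) • multizeta F ![w] := by
  have hw0 : 0 < w := hw ▸ pow_pos Fintype.card_pos _
  refine multizeta_eq_smul_of_telescope ha hb hw0 _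
    (fun d ↦ if d = 0 then 0 else -c * powerSum F (d - 1) w) (by simp) ?_ fun d ↦ ?_
  · rw [← tendsto_add_atTop_iff_nat 1]
    simp only [Nat.add_eq_zero_iff, one_ne_zero, and_false, if_false, Nat.add_sub_cancel, map_mul]
    have := (hasSum_multizeta_one F hw0).summable.tendsto_atTop_zero.const_mul
      (algebraMap (RatFunc F) (RatFunc.CompletionAtInfty F) (-c))
    simpa using this
  · have hbr : bracket F (d + 2) ^ Fintype.card F ^ e = bracket F 2 ^ Fintype.card F ^ e +
        bracket F d ^ Fintype.card F ^ (e + 2) := by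
      have : bracket F d ^ Fintype.card F ^ 2 = bracket F (d + 2) - bracket F 2 := by
        simp only [bracket, sub_pow_card_pow, ← pow_mul, ← pow_add]
        ring
      rw [add_comm e, pow_add, pow_mul, this, sub_pow_card_pow]
      ring
    rw [h, hbr]
    rcases d with _ | d
    · have h0 : bracket F 0 ^ Fintype.card F ^ (e + 2) = 0 := by
        rw [bracket, pow_zero, pow_one, sub_self, zero_pow (pow_ne_zero _ Fintype.card_ne_zero)]
      simp only [h0, zero_add, one_ne_zero, if_false, if_true, Nat.sub_self]
      ring
    · have h1 : powerSum F d w = -bracket F (d + 1) ^ Fintype.card F ^ (e + 2) *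
          powerSum F (d + 1) w := by
        have h2 := ell_ne_zero (F := F) d
        have h3 := bracket_ne_zero (F := F) d
        rw [hw, powerSum_card_pow, powerSum_card_pow, ell_succ, mul_pow, neg_pow_card_pow]
        field_simp
      simp only [Nat.add_eq_zero_iff, one_ne_zero, and_false, if_false, Nat.add_sub_cancel, h1]
      ring

end Convergence

/-! ### The zeta-like identities -/

section Identities

variable {F : Type*} [Field F] [Fintype F]

/-- Both sides contain `ℓ_{N+1-k+d}`; they differ in the denominators `ℓ_{N-k}` and `ℓ_{N+1-k}`. -/
theorem ellQuot_succ {N k : ℕ} (hk : k ≤ N) (d : ℕ) :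
    ellQuot F N (d + 1) k =
      -bracket F (N + 1 - k) ^ Fintype.card F ^ k * ellQuot F (N + 1) d k := by
  have h1 := ell_ne_zero (F := F) (N - k)
  have h2 := bracket_ne_zero (F := F) (N - k)
  rw [ellQuot, ellQuot, ← neg_pow_card_pow, ← mul_pow, Nat.sub_add_comm hk, ell_succ (N - k),
    ← add_assoc, add_right_comm]
  congr 1
  field_simp

theorem ell_add_two (d : ℕ) : ell F (d + 2) = -bracket F (d + 2) * ell F (d + 1) := by
  rw [ell_succ, mul_comm]

variable [DecidableEq (RatFunc F)]

theorem multizeta_sub_sum {n s : ℕ} {k : Fin s → ℕ} (hn : 0 < n) (hs : s < Fintype.card F)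
    (hk : ∀ i, k i < n) :
    multizeta F ![Fintype.card F ^ n - ∑ i, Fintype.card F ^ k i,
        (Fintype.card F - 1) * Fintype.card F ^ n] =
      ((-1) ^ s / ell F 1 ^ (Fintype.card F ^ n) *
        ∏ i, bracket F (n - k i) ^ (Fintype.card F ^ k i)) •
        multizeta F ![Fintype.card F ^ (n + 1) - ∑ i, Fintype.card F ^ k i] := by
  obtain ⟨N, rfl⟩ := Nat.exists_eq_add_of_lt hn
  rw [zero_add] at *
  have hq : 1 < Fintype.card F := Fintype.one_lt_card
  have hk' : ∀ i, k i ≤ N := fun i ↦ Nat.lt_succ_iff.1 (hk i)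
  have hsum : ∑ i, Fintype.card F ^ k i < Fintype.card F ^ (N + 1) := by
    calc ∑ i, Fintype.card F ^ k i ≤ ∑ _i : Fin s, Fintype.card F ^ N :=
          Finset.sum_le_sum fun i _ ↦ Nat.pow_le_pow_right hq.le (hk' i)
      _ = s * Fintype.card F ^ N := by simp
      _ < Fintype.card F * Fintype.card F ^ N :=
          Nat.mul_lt_mul_of_pos_right hs (pow_pos (by omega) _)
      _ = _ := (pow_succ' _ _).symm
  have hle : Fintype.card F ^ (N + 1) ≤ Fintype.card F ^ (N + 1 + 1) :=
    Nat.pow_le_pow_right hq.le (Nat.le_succ _)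
  refine multizeta_eq_smul (by omega)
    (Nat.mul_pos (by omega) (pow_pos (by omega) _)) (by omega) _ fun d ↦ ?_
  -- `q ^ (N + 1)` is read as `q * q ^ N`, so that up to `q - 1` powers may be subtracted
  rw [powerSum_eq (N := N) (m := Fintype.card F) hk' (by simpa using hs) le_rfl
      (by rw [Nat.sub_add_cancel hsum.le, pow_succ']),
    sum_powerSum (ι := Unit) (k := fun _ ↦ N + 1) (N := N + 1 + 1) (m := 1) (by simp) (by simp)
      hq.le (by
        rw [Fintype.sum_unique, pow_succ' _ (N + 1), Nat.sub_one_mul, one_mul]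
        exact Nat.sub_add_cancel (Nat.le_mul_of_pos_left _ (by omega))),
    powerSum_eq (N := N + 1) (m := Fintype.card F) (fun i ↦ (hk i).le) (by simpa using hs) le_rfl
      (by rw [Nat.sub_add_cancel (hsum.le.trans hle), pow_succ'])]
  have h1 : ∏ i, ellQuot F N (d + 1) (k i) =
      (-1) ^ s * (∏ i, bracket F (N + 1 - k i) ^ Fintype.card F ^ k i) *
        ∏ i, ellQuot F (N + 1) d (k i) := by
    rw [Finset.prod_congr rfl fun i _ ↦ ellQuot_succ (hk' i) d, Finset.prod_mul_distrib,
      Finset.prod_neg]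
    simp
  rw [h1, Fintype.prod_unique (fun _ : Unit ↦ _), ellQuot, Nat.add_sub_cancel_left, add_comm 1 d,
    pow_succ _ (N + 1), pow_succ _ N, pow_one, ← pow_mul, ← pow_mul, div_pow, ← pow_succ]
  have h2 := ell_ne_zero (F := F) (d + 1)
  have h3 := ell_ne_zero (F := F) d
  have h4 := ell_ne_zero (F := F) 1
  field_simp

theorem multizeta_mul_card_pow {n s₁ s₂ : ℕ} {k : Fin s₂ → ℕ} (hk : ∀ i, k i ≤ n + 1)
    (hs₁ : 1 ≤ s₁) (hs : s₁ + s₂ ≤ Fintype.card F) {a b : ℕ} (ha : a = s₁ * Fintype.card F ^ n)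
    (hb : b = s₁ * (Fintype.card F ^ (n + 1) - Fintype.card F ^ n) +
      ∑ i, (Fintype.card F ^ (n + 1) - Fintype.card F ^ k i)) :
    multizeta F ![a, b] = (1 / ell F 1 ^ (s₁ * Fintype.card F ^ n)) • multizeta F ![a + b] := by
  have hq : 1 < Fintype.card F := Fintype.one_lt_card
  have hlt : Fintype.card F ^ n < Fintype.card F ^ (n + 1) := Nat.pow_lt_pow_right hq (by omega)
  have ha0 : 0 < a := ha ▸ Nat.mul_pos hs₁ (pow_pos (by omega) _)
  have hb0 : 0 < b := by
    rw [hb]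
    exact Nat.add_pos_left (Nat.mul_pos hs₁ (by omega)) _
  have hb' : b + (s₁ * Fintype.card F ^ n + ∑ i, Fintype.card F ^ k i) =
      (s₁ + s₂) * Fintype.card F ^ (n + 1) := by
    have h1 : ∑ i, (Fintype.card F ^ (n + 1) - Fintype.card F ^ k i) +
        ∑ i, Fintype.card F ^ k i = s₂ * Fintype.card F ^ (n + 1) := by
      rw [← Finset.sum_add_distrib, Finset.sum_congr rfl fun i _ ↦ Nat.sub_add_cancel
        (Nat.pow_le_pow_right hq.le (hk i))]
      simp
    have h2 : s₁ * (Fintype.card F ^ (n + 1) - Fintype.card F ^ n) + s₁ * Fintype.card F ^ n =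
        s₁ * Fintype.card F ^ (n + 1) := by
      rw [← mul_add, Nat.sub_add_cancel hlt.le]
    rw [hb, add_mul, ← h1, ← h2]
    ring
  refine multizeta_eq_smul ha0 hb0 (by omega) _ fun d ↦ ?_
  rw [powerSum_eq (ι := Fin 0) (k := Fin.elim0) (N := n) (m := s₁) (e := a) (fun i ↦ i.elim0)
      (by simpa [Nat.pos_iff_ne_zero] using (by omega : s₁ ≠ 0)) (by omega) (by simpa using ha),
    sum_powerSum (ι := Fin s₁ ⊕ Fin s₂) (k := Sum.elim (fun _ ↦ n) k) (N := n + 1) (m := s₁ + s₂)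
      (by simpa using hk) (by simp) hs (by simpa using hb'),
    powerSum_eq (N := n + 1) (m := s₁ + s₂) hk
      (by simpa [Nat.pos_iff_ne_zero] using (by omega : s₁ ≠ 0)) hs
      (by rw [← hb', ha]; ring)]
  rw [Fintype.prod_sum_type]
  simp only [Sum.elim_inl, Sum.elim_inr, Finset.prod_const, Finset.card_univ, Fintype.card_fin,
    Finset.univ_eq_empty, Finset.prod_empty]
  rw [ellQuot, Nat.add_sub_cancel_left, add_comm 1 d, ← pow_mul, ← pow_mul, div_pow,
    mul_comm (Fintype.card F ^ n)]
  have h2 := ell_ne_zero (F := F) (d + 1)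
  have h4 := ell_ne_zero (F := F) 1
  field_simp

theorem multizeta_sq_sub :
    multizeta F ![Fintype.card F ^ 2 - (Fintype.card F - 1),
        (Fintype.card F - 1) * (Fintype.card F ^ 2 + 1)] =
      ((1 - bracket F 2 ^ Fintype.card F) /
        (ell F 1 ^ (Fintype.card F ^ 2 - 1) * ell F 2)) • multizeta F ![Fintype.card F ^ 3] := by
  have hq : 1 < Fintype.card F := Fintype.one_lt_card
  obtain ⟨p, hp⟩ : ∃ p, Fintype.card F = p + 1 := ⟨Fintype.card F - 1, by omega⟩
  have hp0 : 0 < p := by omega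
  have hsq : (p + 1) ^ 2 - p = p * (p + 1) + 1 := by
    rw [Nat.sub_eq_iff_eq_add (by nlinarith)]; ring
  have h := multizeta_eq_smul_of_bracket (F := F) (a := Fintype.card F ^ 2 - (Fintype.card F - 1))
    (b := (Fintype.card F - 1) * (Fintype.card F ^ 2 + 1)) (w := Fintype.card F ^ 3)
    (by simp [hp, hsq]) (by simp [hp, hp0]) 1 rfl
    (1 / (ell F 1 ^ (Fintype.card F ^ 2 - 1) * ell F 2)) fun d ↦ ?_
  · rw [h, pow_one, one_div_mul_eq_div]
  -- `a = q * q - (q - 1)` and `b = q * q ^ 2 - ((q - 1) * q + 1)`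
  · rw [powerSum_eq (ι := Fin p) (k := fun _ ↦ 0) (N := 1) (m := Fintype.card F) (by simp)
        (by simp [hp]) le_rfl (by simp [hp, hsq]; ring),
      sum_powerSum (ι := Fin p ⊕ Unit) (k := Sum.elim (fun _ ↦ 1) (fun _ ↦ 0)) (N := 2)
        (m := Fintype.card F) (by simp) (by simp [hp]) le_rfl (by simp [hp]; ring),
      powerSum_card_pow, Fintype.prod_sum_type]
    simp only [Sum.elim_inl, Sum.elim_inr, Finset.prod_const, Finset.card_univ, Fintype.card_fin,
      ellQuot]
    have hd := ell_ne_zero (F := F) d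
    have hd1 := ell_ne_zero (F := F) (d + 1)
    have h1 := ell_ne_zero (F := F) 1
    have h2 := ell_ne_zero (F := F) 2
    have hsub : (p + 1) ^ 2 - 1 = p * (p + 1) + p := by
      rw [Nat.sub_eq_iff_eq_add (Nat.one_le_pow _ _ (by omega))]; ring
    rw [← neg_pow_card_pow, hp, hsub]
    simp only [Nat.sub_zero, Nat.reduceSub, add_comm 1 (d + 1), add_comm 1 d, add_comm 2 d,
      add_assoc, Nat.reduceAdd, ell_add_two d, Fintype.card_unit, pow_one]
    simp only [div_pow, div_mul_eq_mul_div, mul_div_assoc', div_div, one_mul, mul_one]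
    rw [div_eq_div_iff (by simp [hd, hd1, h1, h2]) (by simp [hd, h1, h2])]
    ring

theorem multizeta_two_mul_sub_one :
    multizeta F ![2 * Fintype.card F - 1,
        (Fintype.card F - 1) * (Fintype.card F ^ 2 + Fintype.card F - 1)] =
      ((1 - bracket F 2 ^ Fintype.card F) /
        (ell F 1 ^ (Fintype.card F + 1) * ell F 2 ^ (Fintype.card F - 1))) •
          multizeta F ![Fintype.card F ^ 3] := by
  have hq : 1 < Fintype.card F := Fintype.one_lt_card
  obtain ⟨p, hp⟩ : ∃ p, Fintype.card F = p + 1 := ⟨Fintype.card F - 1, by omega⟩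
  have hp0 : 0 < p := by omega
  have h := multizeta_eq_smul_of_bracket (F := F) (a := 2 * Fintype.card F - 1)
    (b := (Fintype.card F - 1) * (Fintype.card F ^ 2 + Fintype.card F - 1))
    (w := Fintype.card F ^ 3)
    (by omega)
    (Nat.mul_pos (by omega) (by have := pow_pos (by omega : 0 < Fintype.card F) 2; omega)) 1 rfl
    (1 / (ell F 1 ^ (Fintype.card F + 1) * ell F 2 ^ (Fintype.card F - 1))) fun d ↦ ?_
  · rw [h, pow_one, one_div_mul_eq_div]
  -- `a = 2 * q - 1` and `b = q * q ^ 2 - (q + (q - 1))`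
  · rw [powerSum_eq (ι := Unit) (k := fun _ ↦ 0) (N := 1) (m := 2) (by simp)
        (by simp) hq (by simp [hp]; omega),
      sum_powerSum (ι := Unit ⊕ Fin p) (k := Sum.elim (fun _ ↦ 1) (fun _ ↦ 0)) (N := 2)
        (m := Fintype.card F) (by simp) (by simp [hp, add_comm]) le_rfl
        (by simp [hp]; ring),
      powerSum_card_pow, Fintype.prod_sum_type]
    simp only [Sum.elim_inl, Sum.elim_inr, Finset.prod_const, Finset.card_univ, Fintype.card_fin,
      ellQuot, Fintype.card_unit, pow_one]
    have hd := ell_ne_zero (F := F) d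
    have hd1 := ell_ne_zero (F := F) (d + 1)
    have h1 := ell_ne_zero (F := F) 1
    have h2 := ell_ne_zero (F := F) 2
    have hbr := neg_pow_card_pow (F := F) 1 (bracket F (d + 2))
    rw [pow_one] at hbr
    rw [← hbr, hp]
    simp only [Nat.sub_zero, Nat.reduceSub, add_comm 1 (d + 1), add_comm 1 d, add_comm 2 d,
      add_assoc, Nat.reduceAdd, ell_add_two d, Nat.add_sub_cancel]
    simp only [div_pow, div_mul_eq_mul_div, mul_div_assoc', div_div, one_mul, mul_one]
    rw [div_eq_div_iff (by simp [hd, hd1, h1, h2]) (by simp [hd, h1, h2])]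
    ring

theorem multizeta_one_sq_sub_one :
    multizeta F ![1, Fintype.card F ^ 2 - 1] =
      (1 / ell F 1 + 1 / ell F 2) • multizeta F ![Fintype.card F ^ 2] := by
  have hq : 1 < Fintype.card F := Fintype.one_lt_card
  have h1 := ell_ne_zero (F := F) 1
  have h2 := ell_ne_zero (F := F) 2
  have hq2 : 1 < Fintype.card F ^ 2 := Nat.one_lt_pow (by omega) hq
  have h := multizeta_eq_smul_of_bracket (F := F) (a := 1) (b := Fintype.card F ^ 2 - 1)
    (w := Fintype.card F ^ 2) one_pos (by omega) 0 rfl (1 / ell F 2) fun d ↦ ?_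
  · rw [h, pow_zero, pow_one]
    congr 1
    -- `1 / ℓ_1 = -[2] / ℓ_2`
    have h3 := ell_add_two (F := F) 0
    rw [zero_add, zero_add] at h3
    have hb := bracket_ne_zero (F := F) 1
    rw [h3]
    field_simp
    ring
  · rw [powerSum_eq (ι := Fin 0) (k := Fin.elim0) (N := 0) (m := 1) (fun i ↦ i.elim0) (by simp)
        hq.le (by simp),
      sum_powerSum (ι := Unit) (k := fun _ ↦ 0) (N := 2) (m := 1) (by simp) (by simp) hq.le
        (by simp; omega),
      powerSum_card_pow]
    have hd := ell_ne_zero (F := F) d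
    have hd1 := ell_ne_zero (F := F) (d + 1)
    simp only [Finset.prod_const, Finset.card_univ, Fintype.card_unit, ellQuot,
      Nat.sub_zero, pow_zero, pow_one, add_comm 2 d, ell_add_two d,
      Finset.univ_eq_empty, Finset.prod_empty]
    field_simp

theorem multizeta_sub_one {n k : ℕ} (hq : 2 < Fintype.card F) (hk : k ≤ n + 1) :
    multizeta F ![(Fintype.card F - 1) * Fintype.card F ^ n - 1,
        (Fintype.card F - 1) * Fintype.card F ^ (n + 1) + Fintype.card F ^ n -
          Fintype.card F ^ k] =
      (-(bracket F (n + 1) / bracket F 1 ^ ((Fintype.card F - 1) * Fintype.card F ^ n))) •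
        multizeta F ![Fintype.card F ^ (n + 2) - Fintype.card F ^ k - 1] := by
  obtain ⟨p, hp⟩ : ∃ p, Fintype.card F = p + 1 := ⟨Fintype.card F - 1, by omega⟩
  have hp2 : 2 ≤ p := by omega
  have hn : 0 < Fintype.card F ^ n := pow_pos (by omega) _
  have hkn : Fintype.card F ^ k ≤ Fintype.card F ^ (n + 1) :=
    Nat.pow_le_pow_right (by omega) hk
  have hpn : 2 * Fintype.card F ^ n ≤ p * Fintype.card F ^ n := Nat.mul_le_mul_right _ hp2
  have hpn1 : 2 * Fintype.card F ^ (n + 1) ≤ p * Fintype.card F ^ (n + 1) :=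
    Nat.mul_le_mul_right _ hp2
  have hs1 : Fintype.card F ^ (n + 1) = p * Fintype.card F ^ n + Fintype.card F ^ n := by
    rw [pow_succ', hp]; ring
  have hs2 : Fintype.card F ^ (n + 2) =
      p * Fintype.card F ^ (n + 1) + Fintype.card F ^ (n + 1) := by
    rw [pow_succ', hp]; ring
  have hqp : Fintype.card F - 1 = p := by omega
  rw [hqp]
  refine multizeta_eq_smul (by omega) (by omega) (by omega) _ fun d ↦ ?_
  -- `b = q * q ^ (n + 1) - ((q - 1) * q ^ n + q ^ k)`: all `q` available powers are used
  rw [powerSum_eq (ι := Unit) (k := fun _ ↦ 0) (N := n) (m := p) (by simp) (by simp; omega)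
      (by omega) (by simp; omega),
    sum_powerSum (ι := Fin p ⊕ Unit) (k := Sum.elim (fun _ ↦ n) (fun _ ↦ k)) (N := n + 1)
      (m := Fintype.card F) (by simpa using hk) (by simp [hp]) le_rfl
      (by rw [← pow_succ', hs2]; simp; omega),
    powerSum_eq (ι := Unit ⊕ Unit) (k := Sum.elim (fun _ ↦ k) (fun _ ↦ 0)) (N := n + 1)
      (m := Fintype.card F) (by simpa using hk) (by simp; omega) le_rfl
      (by rw [← pow_succ', hs2]; simp; omega), Fintype.prod_sum_type, Fintype.prod_sum_type]
  simp only [Sum.elim_inl, Sum.elim_inr, Finset.prod_const, Finset.card_univ, Fintype.card_fin,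
    Fintype.card_unit, pow_one]
  rw [ellQuot_succ (Nat.zero_le n)]
  have hd := ell_ne_zero (F := F) d
  have hd1 := ell_ne_zero (F := F) (d + 1)
  have hb := bracket_ne_zero (F := F) 0
  have hbq : (-bracket F 1) ^ (p * Fintype.card F ^ n) =
      bracket F 1 ^ (p * Fintype.card F ^ n) := by
    -- `(-1) ^ q = -1` also covers characteristic two, where `q - 1` is odd
    have h1 : (-1 : RatFunc F) ^ p = 1 := by
      have h2 := neg_pow_card_pow (F := F) 1 (1 : RatFunc F)
      rw [pow_one, one_pow, hp, pow_succ] at h2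
      exact mul_right_cancel₀ (neg_ne_zero.2 one_ne_zero) (h2.trans (one_mul _).symm)
    rw [neg_pow, pow_mul, h1, one_pow, one_mul]
  have h3 : ellQuot F (n + 1) d n = (ell F (d + 1) / -bracket F 1) ^ Fintype.card F ^ n := by
    rw [ellQuot, Nat.add_sub_cancel_left, add_comm 1 d, ell_one]
  rw [h3, ← hbq, ← pow_mul, mul_comm (Fintype.card F ^ n) p, pow_zero, pow_one,
    Nat.sub_zero, ← pow_mul, mul_comm (Fintype.card F ^ n) p, div_pow]
  rw [zero_add] at hb
  field_simp

end Identities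

end MultizetaFq

end

theorem theorem3p1 {F : Type*} [Field F] [Fintype F] [DecidableEq (RatFunc F)]
    (q : ℕ) (hq : Fintype.card F = q) :
    -- the series defining the multizeta values converge
    (∀ (r : ℕ) (s : Fin r → ℕ), (∀ i, 0 < s i) → Summable (MultizetaFq.multizetaTerm F s)) ∧
    -- first family
    (∀ (n s : ℕ) (k : Fin s → ℕ), 0 < n → 1 ≤ s → s < q → (∀ i, k i < n) →
      MultizetaFq.multizeta F ![q ^ n - ∑ i, q ^ k i, (q - 1) * q ^ n] =
        ((-1) ^ s / MultizetaFq.ell F 1 ^ (q ^ n) *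
            ∏ i, MultizetaFq.bracket F (n - k i) ^ (q ^ k i)) •
          MultizetaFq.multizeta F ![q ^ (n + 1) - ∑ i, q ^ k i]) ∧
    -- second family
    (∀ (n s₁ s₂ : ℕ) (k : Fin s₂ → ℕ), (∀ i, k i ≤ n + 1) → 1 ≤ s₁ → s₁ ≤ q → s₂ ≤ q - s₁ →
      ∀ a b : ℕ, a = s₁ * q ^ n →
        b = s₁ * (q ^ (n + 1) - q ^ n) + ∑ i, (q ^ (n + 1) - q ^ k i) →
        MultizetaFq.multizeta F ![a, b] =
          (1 / MultizetaFq.ell F 1 ^ (s₁ * q ^ n)) • MultizetaFq.multizeta F ![a + b]) ∧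
    -- two identities of weight `q ^ 3`
    (MultizetaFq.multizeta F ![q ^ 2 - (q - 1), (q - 1) * (q ^ 2 + 1)] =
      ((1 - MultizetaFq.bracket F 2 ^ q) /
          (MultizetaFq.ell F 1 ^ (q ^ 2 - 1) * MultizetaFq.ell F 2)) •
        MultizetaFq.multizeta F ![q ^ 3]) ∧
    (MultizetaFq.multizeta F ![2 * q - 1, (q - 1) * (q ^ 2 + q - 1)] =
      ((1 - MultizetaFq.bracket F 2 ^ q) /
          (MultizetaFq.ell F 1 ^ (q + 1) * MultizetaFq.ell F 2 ^ (q - 1))) •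
        MultizetaFq.multizeta F ![q ^ 3]) ∧
    -- an identity of weight `q ^ 2`
    (MultizetaFq.multizeta F ![1, q ^ 2 - 1] =
      (1 / MultizetaFq.ell F 1 + 1 / MultizetaFq.ell F 2) •
        MultizetaFq.multizeta F ![q ^ 2]) ∧
    -- last family; the integer `n - j` satisfies `0 ≤ n - j ≤ n + 1`
    (2 < q → ∀ (n : ℕ) (j : ℤ), -1 ≤ j → j ≤ n →
      MultizetaFq.multizeta F
          ![(q - 1) * q ^ n - 1, (q - 1) * q ^ (n + 1) + q ^ n - q ^ ((n : ℤ) - j).toNat] =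
        (-(MultizetaFq.bracket F (n + 1) / MultizetaFq.bracket F 1 ^ ((q - 1) * q ^ n))) •
          MultizetaFq.multizeta F ![q ^ (n + 2) - q ^ ((n : ℤ) - j).toNat - 1]) := by
  subst hq
  refine ⟨fun r s hs ↦ MultizetaFq.summable_multizetaTerm s hs,
    fun n s k hn _ hs hk ↦ MultizetaFq.multizeta_sub_sum hn hs hk,
    fun n s₁ s₂ k hk h1 h2 h3 a b ha hb ↦
      MultizetaFq.multizeta_mul_card_pow hk h1 (by omega) ha hb,
    MultizetaFq.multizeta_sq_sub, MultizetaFq.multizeta_two_mul_sub_one,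
    MultizetaFq.multizeta_one_sq_sub_one,
    fun hq n j hj hjn ↦ MultizetaFq.multizeta_sub_one hq (by omega)⟩
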